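/- Let $(R,\mathfrak m)$ be a one-dimensional (Noetherian) Cohen--Macaulay local ring of minimal multiplicity, that is, $\mathrm v(R)=\mathrm e(R)$, where $\mathrm v(R)$ is the minimal number of generators of $\mathfrak m$ and $\mathrm e(R)=\lim_{n\to\infty}\ell_R(R/\mathfrak m^n)/n$ is the multiplicity of $R$. An $\mathfrak m$-primary ideal $I$ of $R$ is called an Ulrich ideal if it contains a parameter ideal $Q=(a)$ as a reduction such that $I\ne Q$, $I^2=QI$, and $I/I^2$ is a free $R/I$-module. If the $\mathfrak m$-adic completion $\widehat R$ of $R$ is a reduced ring, then $R$ has only finitely many Ulrich ideals. -/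

import Mathlib

open Filter Topology IsLocalRing

/-- A Noetherian local ring `R` is Cohen-Macaulay if its depth equals its dimension, that is, if
there is an `R`-regular sequence (necessarily inside the maximal ideal, as it generates a proper
ideal) whose length is the Krull dimension of `R`. -/
def IsCohenMacaulayLocal (R : Type*) [CommRing R] [IsLocalRing R] [IsNoetherianRing R] : Prop :=
  ∃ rs : List R, RingTheory.Sequence.IsRegular R rs ∧
    ((rs.length : ℕ) : WithBot ℕ∞) = ringKrullDim R

/-- `Q` is a parameter ideal: it is generated by `d = dim R` elements and its radical is the
maximal ideal. -/
def IsParameterIdeal {R : Type*} [CommRing R] [IsLocalRing R] (Q : Ideal R) : Prop :=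
  Q.radical = maximalIdeal R ∧
    ∃ d : ℕ, ringKrullDim R = ((d : ℕ) : WithBot ℕ∞) ∧
      ∃ a : Fin d → R, Q = Ideal.span (Set.range a)

/-- `Q` is a reduction of `I`: `Q ⊆ I` and `I ^ (n + 1) = Q I ^ n` for some `n ≥ 0`. -/
def IsReductionOf {R : Type*} [CommRing R] (Q I : Ideal R) : Prop :=
  Q ≤ I ∧ ∃ n : ℕ, I ^ (n + 1) = Q * I ^ n

/-- `I` is an Ulrich ideal of the local ring `R`: it is primary to the maximal ideal and contains
a parameter ideal `Q` as a reduction such that `I ≠ Q`, `I ^ 2 = Q I`, and `I / I ^ 2`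
is a free `R / I`-module (`I.Cotangent` is `I / I ^ 2`). -/
def IsUlrichIdeal {R : Type*} [CommRing R] [IsLocalRing R] (I : Ideal R) : Prop :=
  (I.IsPrimary ∧ I.radical = maximalIdeal R) ∧
    ∃ Q : Ideal R, IsParameterIdeal Q ∧ IsReductionOf Q I ∧
      I ≠ Q ∧ I ^ 2 = Q * I ∧ Module.Free (R ⧸ I) I.Cotangent

/-- The embedding dimension of `R`: the minimal number of generators of the maximal ideal. -/
noncomputable def embDim (R : Type*) [CommRing R] [IsLocalRing R] : ℕ :=
  (maximalIdeal R).spanFinrank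

/-- The multiplicity of the one-dimensional Noetherian local ring `R` with respect to the ideal
`𝔞`, primary to the maximal ideal, is `e`: the lengths `ℓ(R / 𝔞 ^ n)` (which are finite) satisfy
`ℓ(R / 𝔞 ^ n) / n → e` as `n → ∞`. -/
def HasMultiplicity {R : Type*} [CommRing R] (𝔞 : Ideal R) (e : ℝ) : Prop :=
  Tendsto (fun n : ℕ => ((Module.length R (R ⧸ 𝔞 ^ n)).toNat : ℝ) / (n : ℝ)) atTop (𝓝 e)

/-- The one-dimensional Cohen-Macaulay local ring `R` has minimal multiplicity: its multiplicity
(with respect to the maximal ideal) equals its embedding dimension. -/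
def HasMinimalMultiplicity (R : Type*) [CommRing R] [IsLocalRing R] : Prop :=
  HasMultiplicity (maximalIdeal R) (embDim R : ℝ)

/-! Suppose first that `𝔪 ^ 2 = a 𝔪` with `a` a nonzerodivisor. For an Ulrich ideal `I`, freeness of
`I / I ^ 2` together with `I ≠ (b)` gives `(b) : I = I`, whence `𝔪 I = a I` and `𝔪 ≤ (a) + I`. Let
`l` be the least exponent with `a ^ l ∈ I`; then products of elements of `I` lie in `a ^ l I`. For
`i < l` the ideal `(a ^ (i + 1)) + I` is determined by `(a ^ i) + I` (`mem_sup_succ_iff`). Hence `I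
= (a ^ l) + I'` whenever `I'` has order `l' ≥ l`: the Ulrich ideals form a chain, with at most one
for each order.

Infinitely many of them would therefore have unbounded orders. Starting from an element of one such
`I`, of order `l ≥ 2`, choose successive elements of Ulrich ideals of growing order, each congruent
to the previous one modulo a growing power of `𝔪`. Their squares tend to zero, so the limit in the
completion squares to zero and vanishes by reducedness. This forces `I ≤ 𝔪 ^ l`, which
`not_le_maximalIdeal_pow` excludes.

The element `a` may fail to exist over a finite residue field, so it is taken in `S = R[X]`
localized at `𝔪 R[X]`: the generic combination of generators of `𝔪` is superficial there, and
minimal multiplicity then yields `𝔪 ^ 2 = a 𝔪` by counting lengths. Ideals of `R` embed in those of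
`S` with their order relations, so the completion argument stays in `R` and reducedness of the
completion of `S` is never needed. -/

/-- `I` satisfies `I ^ 2 = b I` with `b ∈ I` a nonzerodivisor and `I ≠ (b)`, and `x` is a finite
family generating `I` whose classes form a basis of `I / I ^ 2` over `R / I`. -/
structure IsUlrichFamily {R ι : Type*} [CommRing R] [IsLocalRing R] [Fintype ι]
    (I : Ideal R) (b : R) (x : ι → R) : Prop where
  le_maximalIdeal : I ≤ maximalIdeal R
  exists_pow_le : ∃ N, maximalIdeal R ^ N ≤ I
  mem : b ∈ I
  mem_nonZeroDivisors : b ∈ nonZeroDivisors R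
  sq_eq : I ^ 2 = Ideal.span {b} * I
  ne_span : I ≠ Ideal.span {b}
  span_eq : Ideal.span (Set.range x) = I
  mem_of_sum_mem : ∀ r : ι → R, ∑ i, r i * x i ∈ I ^ 2 → ∀ i, r i ∈ I

/-! ### Ulrich ideals when the maximal ideal satisfies `𝔪 ^ 2 = a 𝔪`. -/

namespace IsUlrichFamily

variable {R ι : Type*} [CommRing R] [IsLocalRing R] [Fintype ι] {I : Ideal R} {b : R} {x : ι → R}

theorem exists_mul_eq (h : IsUlrichFamily I b x) {y z : R} (hy : y ∈ I) (hz : z ∈ I) :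
    ∃ w ∈ I, y * z = b * w := by
  have : y * z ∈ Ideal.span {b} * I := by
    rw [← h.sq_eq, sq]; exact Ideal.mul_mem_mul hy hz
  obtain ⟨w, hw, e⟩ := Ideal.mem_span_singleton_mul.1 this
  exact ⟨w, hw, e.symm⟩

theorem exists_sum_eq (h : IsUlrichFamily I b x) {y : R} (hy : y ∈ I) :
    ∃ c : ι → R, ∑ i, c i * x i = y :=
  Ideal.mem_span_range_iff_exists_fun.1 (h.span_eq ▸ hy)

theorem family_mem (h : IsUlrichFamily I b x) (i : ι) : x i ∈ I :=
  h.span_eq ▸ Ideal.subset_span ⟨i, rfl⟩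

theorem one_notMem (h : IsUlrichFamily I b x) : (1 : R) ∉ I := fun h1 =>
  (Ideal.ne_top_iff_one _).1 (maximalIdeal.isMaximal R).ne_top (h.le_maximalIdeal h1)

theorem coeff_sub_mem (h : IsUlrichFamily I b x) {r s : ι → R}
    (e : ∑ i, r i * x i = ∑ i, s i * x i) (i : ι) : r i - s i ∈ I := by
  refine h.mem_of_sum_mem (fun i => r i - s i) ?_ i
  simp [sub_mul, e]

/-- The generator `b` of the reduction is a minimal generator of `I`. -/
theorem notMem_mul [IsNoetherianRing R] (h : IsUlrichFamily I b x) :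
    b ∉ maximalIdeal R * I := by
  intro hb
  have h1 : I ^ 2 ≤ maximalIdeal R • I ^ 2 := by
    conv_lhs => rw [h.sq_eq]
    rw [smul_eq_mul, sq, ← mul_assoc]
    exact Ideal.mul_mono_left ((Ideal.span_singleton_le_iff_mem _).2 hb)
  have h2 : I ^ 2 = ⊥ :=
    Submodule.eq_bot_of_le_smul_of_le_jacobson_bot _ _ (IsNoetherian.noetherian _) h1
      (jacobson_eq_maximalIdeal _ bot_ne_top).ge
  have h3 : b * b ∈ I ^ 2 := by rw [sq]; exact Ideal.mul_mem_mul h.mem h.mem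
  rw [h2, Ideal.mem_bot, mul_right_mem_nonZeroDivisors_eq_zero_iff h.mem_nonZeroDivisors] at h3
  exact zero_notMem_nonZeroDivisors (h3 ▸ h.mem_nonZeroDivisors)

theorem exists_isUnit_of_notMem (h : IsUlrichFamily I b x) {c : ι → R}
    (hc : ∑ i, c i * x i ∉ maximalIdeal R * I) : ∃ i, IsUnit (c i) := by
  by_contra! hcon
  exact hc (Ideal.sum_mem _ fun i _ => Ideal.mul_mem_mul ((mem_maximalIdeal _).2 (hcon i))
    (h.family_mem i))

theorem exists_unit_coeff [IsNoetherianRing R] (h : IsUlrichFamily I b x) :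
    ∃ c : ι → R, ∑ i, c i * x i = b ∧ ∃ i, IsUnit (c i) := by
  obtain ⟨c, hc⟩ := h.exists_sum_eq h.mem
  exact ⟨c, hc, h.exists_isUnit_of_notMem (hc ▸ h.notMem_mul)⟩

/-- A generator other than one with unit coefficient in `b` already detects `(b) : I ≤ I`; this is
the main use of freeness of `I / I ^ 2`. -/
theorem exists_colon_le [IsNoetherianRing R] (h : IsUlrichFamily I b x) :
    ∃ y ∈ I, ∀ r s : R, r * y = b * s → r ∈ I := by
  classical
  obtain ⟨c, hc, j, hj⟩ := h.exists_unit_coeff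
  -- With a single generator, `b` would be a unit multiple of it and `I = (b)`.
  obtain ⟨i, hij⟩ : ∃ i, i ≠ j := by
    by_contra! hcon
    have hb : b = c j * x j := by
      rw [← hc, Finset.sum_eq_single j (fun i _ hi => absurd (hcon i) hi) (by simp)]
    refine h.ne_span (le_antisymm ?_ ((Ideal.span_singleton_le_iff_mem _).2 h.mem))
    conv_lhs => rw [← h.span_eq]
    rw [Ideal.span_le]
    rintro _ ⟨i, rfl⟩
    rw [hcon i, hb, SetLike.mem_coe, Ideal.mem_span_singleton]
    exact (hj.dvd_mul_left).1 dvd_rfl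
  refine ⟨x i, h.family_mem i, fun r s hrs => ?_⟩
  -- Expand `r x_i = s b` in the generators: coordinate `j` gives `s c_j ∈ I`, so `s ∈ I`, and
  -- coordinate `i` then gives `r ∈ I`.
  have e : ∑ k, (Pi.single i r : ι → R) k * x k = ∑ k, (s * c k) * x k := by
    simp only [mul_assoc, ← Finset.mul_sum, hc]
    rw [Finset.sum_eq_single i (fun k _ hk => by simp [hk]) (by simp)]
    simp [hrs, mul_comm]
  have h1 := h.coeff_sub_mem e
  have h2 := h1 j
  rw [Pi.single_eq_of_ne hij.symm, zero_sub, neg_mem_iff] at h2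
  have hs : s ∈ I := (Ideal.mul_unit_mem_iff_mem I hj).1 h2
  have h3 := h1 i
  rw [Pi.single_eq_same] at h3
  simpa using add_mem h3 (I.mul_mem_right (c i) hs)

variable {a : R}

theorem exists_mul_eq_of_mem_maximalIdeal (hm : maximalIdeal R ^ 2 = Ideal.span {a} * maximalIdeal R)
    {y z : R} (hy : y ∈ maximalIdeal R) (hz : z ∈ maximalIdeal R) :
    ∃ w ∈ maximalIdeal R, y * z = a * w := by
  have : y * z ∈ Ideal.span {a} * maximalIdeal R := by
    rw [← hm, sq]; exact Ideal.mul_mem_mul hy hz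
  obtain ⟨w, hw, e⟩ := Ideal.mem_span_singleton_mul.1 this
  exact ⟨w, hw, e.symm⟩

/-- `𝔪 I = a I`: an Ulrich ideal is a maximally generated module. -/
theorem exists_mul_eq_reduction [IsNoetherianRing R] (h : IsUlrichFamily I b x)
    (ha : a ∈ nonZeroDivisors R)
    (hm : maximalIdeal R ^ 2 = Ideal.span {a} * maximalIdeal R)
    {y z : R} (hy : y ∈ maximalIdeal R) (hz : z ∈ I) : ∃ w ∈ I, y * z = a * w := by
  obtain ⟨t, ht, hcol⟩ := h.exists_colon_le
  obtain ⟨w, hw, e1⟩ := h.exists_mul_eq hz ht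
  obtain ⟨z', _, e2⟩ := exists_mul_eq_of_mem_maximalIdeal hm hy (h.le_maximalIdeal hz)
  obtain ⟨w', _, e3⟩ := exists_mul_eq_of_mem_maximalIdeal hm hy (h.le_maximalIdeal hw)
  -- After cancelling `a`, the relations `z t = b w`, `y z = a z'` and `y w = a w'` give `z' t = b
  -- w'`.
  refine ⟨z', hcol z' w' ?_, e2⟩
  rw [← mul_cancel_left_mem_nonZeroDivisors ha]
  linear_combination t * (-e2) + y * e1 + b * e3

/-- Write `y b = a w` with `w ∈ I`. Modulo `(I : 𝔪)`, the coefficients of `w` are proportional to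
those of `b`, so `a w` is a multiple of `a b` plus an element of `I ^ 2 = b I`; then cancel `b`. -/
theorem maximalIdeal_le_sup [IsNoetherianRing R] (h : IsUlrichFamily I b x)
    (ha : a ∈ nonZeroDivisors R)
    (hm : maximalIdeal R ^ 2 = Ideal.span {a} * maximalIdeal R) :
    maximalIdeal R ≤ Ideal.span {a} ⊔ I := by
  intro y hy
  obtain ⟨w, hw, e⟩ := h.exists_mul_eq_reduction ha hm hy h.mem
  obtain ⟨r, rfl⟩ := h.exists_sum_eq hw
  obtain ⟨c, hc, j, u, hu⟩ := h.exists_unit_coeff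
  -- From `t y = a y'` one gets `t w = y' b`. Comparing coefficients modulo `I` and eliminating `y'`
  -- through the unit `c_j` gives the claim.
  have key (t : R) (ht : t ∈ maximalIdeal R) (i : ι) :
      t * (r i - r j * ↑u⁻¹ * c i) ∈ I := by
    obtain ⟨y', _, hy'⟩ := exists_mul_eq_of_mem_maximalIdeal hm ht hy
    have e1 : ∑ i, (t * r i) * x i = ∑ i, (y' * c i) * x i := by
      simp only [mul_assoc, ← Finset.mul_sum, hc]
      rw [← mul_cancel_left_mem_nonZeroDivisors ha]
      linear_combination -t * e + b * hy'
    have h1 := h.coeff_sub_mem e1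
    have h2 := h1 j
    rw [← hu] at h2
    have h3 := I.sub_mem (h1 i) (I.mul_mem_right (↑u⁻¹ * c i) h2)
    have hu' : (u : R) * ↑u⁻¹ = 1 := u.mul_inv
    convert h3 using 1
    linear_combination (-y' * c i) * hu'
  have hmem (i : ι) : ∃ v ∈ I, a * (r i - r j * ↑u⁻¹ * c i) * x i = b * v := by
    by_cases haU : IsUnit a
    · exfalso
      have h1 : maximalIdeal R ^ 2 = maximalIdeal R := by
        rw [hm, Ideal.span_singleton_eq_top.2 haU, Ideal.top_mul]
      have h2 : maximalIdeal R = ⊥ :=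
        Submodule.eq_bot_of_le_smul_of_le_jacobson_bot _ _ (IsNoetherian.noetherian _)
          (by rw [smul_eq_mul, ← sq, h1]) (jacobson_eq_maximalIdeal _ bot_ne_top).ge
      have h3 := h.le_maximalIdeal h.mem
      rw [h2, Ideal.mem_bot] at h3
      exact zero_notMem_nonZeroDivisors (h3 ▸ h.mem_nonZeroDivisors)
    · exact h.exists_mul_eq (key a ((mem_maximalIdeal _).2 haU) i) (h.family_mem i)
  choose v hv hve using hmem
  have hy' : y = a * (r j * ↑u⁻¹) + ∑ i, v i := by
    rw [← mul_cancel_left_mem_nonZeroDivisors h.mem_nonZeroDivisors, mul_add, Finset.mul_sum,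
      ← Finset.sum_congr rfl fun i _ => hve i]
    simp only [mul_sub, sub_mul, Finset.sum_sub_distrib]
    have e1 : ∑ i, a * (r j * ↑u⁻¹ * c i) * x i = a * (r j * ↑u⁻¹) * b := by
      rw [← hc, Finset.mul_sum]
      exact Finset.sum_congr rfl fun _ _ => by ring
    have e2 : ∑ i, a * r i * x i = a * ∑ i, r i * x i := by
      rw [Finset.mul_sum]
      exact Finset.sum_congr rfl fun _ _ => by ring
    rw [e1, e2]
    linear_combination e
  rw [hy']
  exact Submodule.add_mem_sup (Ideal.mul_mem_right _ _ (Ideal.mem_span_singleton_self a))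
    (Ideal.sum_mem _ fun i _ => hv i)

end IsUlrichFamily

/-! ### The order of an Ulrich ideal and the resulting chain. -/

/-- With `a` generating a reduction of the maximal ideal, `l` is the least exponent with
`a ^ l ∈ I`, and `I` is an ideal with `𝔪 ≤ (a) + I` and `I ^ 2 = a ^ l I`. -/
structure HasUlrichOrder {R : Type*} [CommRing R] [IsLocalRing R] (a : R) (I : Ideal R) (l : ℕ) :
    Prop where
  pow_mem : a ^ l ∈ I
  le_of_pow_mem : ∀ j, a ^ j ∈ I → l ≤ j
  maximalIdeal_le : maximalIdeal R ≤ Ideal.span {a} ⊔ I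
  sq_le : ∀ y ∈ I, ∀ z ∈ I, ∃ w ∈ I, y * z = a ^ l * w

theorem IsUlrichFamily.exists_hasUlrichOrder {R ι : Type*} [CommRing R] [IsLocalRing R]
    [IsNoetherianRing R] [Fintype ι] {I : Ideal R} {a b : R} {x : ι → R}
    (h : IsUlrichFamily I b x) (ham : a ∈ maximalIdeal R) (ha : a ∈ nonZeroDivisors R)
    (hm : maximalIdeal R ^ 2 = Ideal.span {a} * maximalIdeal R) :
    ∃ l, HasUlrichOrder a I l := by
  classical
  have hex : ∃ l, a ^ l ∈ I := by
    obtain ⟨N, hN⟩ := h.exists_pow_le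
    exact ⟨N, hN (Ideal.pow_mem_pow ham N)⟩
  refine ⟨Nat.find hex, Nat.find_spec hex, fun j hj => Nat.find_min' hex hj,
    h.maximalIdeal_le_sup ha hm, ?_⟩
  · intro y hy z hz
    suffices ∀ j ≤ Nat.find hex, ∃ w ∈ I, y * z = a ^ j * w from this _ le_rfl
    intro j
    induction j with
    | zero => exact fun _ => ⟨y * z, I.mul_mem_right _ hy, by simp⟩
    | succ j ih =>
      intro hj
      obtain ⟨w, hw, e⟩ := ih (by omega)
      -- Otherwise `w` has a unit coefficient, and `a ^ j w ∈ I ^ 2` forces `a ^ j ∈ I` with `j`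
      -- below the order. Thus `w ∈ 𝔪 I = a I`, and one more factor `a` comes out.
      have hwm : w ∈ maximalIdeal R * I := by
        by_contra hcon
        obtain ⟨c, rfl⟩ := h.exists_sum_eq hw
        obtain ⟨i, hi⟩ := h.exists_isUnit_of_notMem hcon
        have h1 := h.mem_of_sum_mem (fun i => a ^ j * c i) (by
          simp only [mul_assoc, ← Finset.mul_sum, ← e, sq]
          exact Ideal.mul_mem_mul hy hz) i
        exact Nat.find_min hex (by omega) ((Ideal.mul_unit_mem_iff_mem I hi).1 h1)
      have hle : maximalIdeal R * I ≤ Ideal.span {a} * I := by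
        rw [Ideal.mul_le]
        intro r hr s hs
        obtain ⟨t, ht, e⟩ := h.exists_mul_eq_reduction ha hm hr hs
        rw [e]
        exact Ideal.mul_mem_mul (Ideal.mem_span_singleton_self a) ht
      obtain ⟨w', hw', e'⟩ := Ideal.mem_span_singleton_mul.1 (hle hwm)
      exact ⟨w', hw', by rw [e, ← e', pow_succ, mul_assoc]⟩

namespace HasUlrichOrder

variable {R : Type*} [CommRing R] [IsLocalRing R] {a : R} {I I' : Ideal R} {l l' : ℕ}

/-- `(a ^ (i + 1)) + I` is determined by `(a ^ i) + I`. -/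
theorem mem_sup_succ_iff (h : HasUlrichOrder a I l) (ha : a ∈ nonZeroDivisors R) {i : ℕ}
    (hi : i < l) {z : R} :
    z ∈ Ideal.span {a ^ (i + 1)} ⊔ I ↔
      z ∈ Ideal.span {a ^ i} ⊔ I ∧ z ^ 2 ∈ Ideal.span {a ^ (i + 1)} * (Ideal.span {a ^ i} ⊔ I) := by
  obtain ⟨k, rfl⟩ : ∃ k, l = i + 1 + k := ⟨l - (i + 1), by omega⟩
  simp only [Ideal.mem_span_singleton_sup, Ideal.mem_span_singleton_mul]
  constructor
  · rintro ⟨r, y, hy, rfl⟩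
    obtain ⟨w, hw, e⟩ := h.sq_le y hy y hy
    refine ⟨⟨r * a, y, hy, by ring⟩, a ^ (i + 1) * r ^ 2 + (2 * r * y + a ^ k * w), ?_, ?_⟩
    · exact ⟨a * r ^ 2, 2 * r * y + a ^ k * w,
        add_mem (I.mul_mem_left _ hy) (I.mul_mem_left _ hw), by ring⟩
    · rw [pow_add] at e
      linear_combination -e
  · rintro ⟨⟨r, y, hy, rfl⟩, _, ⟨s, t, ht, rfl⟩, e⟩
    -- If `r` is a unit, the condition on `z ^ 2`, divided by `a ^ i`, puts a unit multiple of `a ^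
    -- i` in `I`, against minimality of `l`. If not, `r ∈ 𝔪 ≤ (a) + I` supplies the missing factor
    -- `a`.
    by_cases hr : IsUnit r
    · exfalso
      obtain ⟨w, hw, e'⟩ := h.sq_le y hy y hy
      have e2 : a ^ i * r ^ 2 = a ^ (i + 1) * s + (a * t - 2 * r * y - a ^ (k + 1) * w) := by
        rw [← mul_cancel_left_mem_nonZeroDivisors (_root_.pow_mem ha i)]
        rw [pow_add] at e'
        linear_combination -e - e'
      have e3 : a ^ i * (r ^ 2 - a * s) ∈ I := by
        have : a ^ i * (r ^ 2 - a * s) = a * t - 2 * r * y - a ^ (k + 1) * w := by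
          linear_combination e2
        rw [this]
        exact sub_mem (sub_mem (I.mul_mem_left _ ht) (I.mul_mem_left _ hy)) (I.mul_mem_left _ hw)
      by_cases haU : IsUnit a
      · have := h.le_of_pow_mem 0 (by
          simpa using (Ideal.unit_mul_mem_iff_mem I (haU.pow _)).1 (by simpa using h.pow_mem))
        omega
      · have hu : IsUnit (r ^ 2 - a * s) := by
          by_contra hcon
          have h1 : a * s ∈ maximalIdeal R := Ideal.mul_mem_right _ _ ((mem_maximalIdeal _).2 haU)
          have h2 := add_mem ((mem_maximalIdeal _).2 hcon) h1
          rw [sub_add_cancel] at h2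
          exact (mem_maximalIdeal _).1 h2 (hr.pow 2)
        have := h.le_of_pow_mem i ((Ideal.mul_unit_mem_iff_mem I hu).1 e3)
        omega
    · obtain ⟨s, y', hy', rfl⟩ := Ideal.mem_span_singleton_sup.1
        (h.maximalIdeal_le ((mem_maximalIdeal _).2 hr))
      exact ⟨s, y' * a ^ i + y, add_mem (I.mul_mem_right _ hy') hy, by ring⟩

/-- Both sides are the unit ideal at `i = 0`, and `mem_sup_succ_iff` gives the same recursion for
both as long as `i` stays below the two orders. -/
theorem sup_eq_sup (h : HasUlrichOrder a I l) (h' : HasUlrichOrder a I' l')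
    (ha : a ∈ nonZeroDivisors R) (hl : l ≤ l') {i : ℕ} (hi : i ≤ l) :
    Ideal.span {a ^ i} ⊔ I = Ideal.span {a ^ i} ⊔ I' := by
  induction i with
  | zero => simp
  | succ i ih =>
    ext z
    rw [h.mem_sup_succ_iff ha (by omega), h'.mem_sup_succ_iff ha (by omega), ih (by omega)]

theorem eq_sup (h : HasUlrichOrder a I l) (h' : HasUlrichOrder a I' l')
    (ha : a ∈ nonZeroDivisors R) (hl : l ≤ l') : I = Ideal.span {a ^ l} ⊔ I' := by
  rw [← h.sup_eq_sup h' ha hl le_rfl, eq_comm, sup_eq_right, Ideal.span_singleton_le_iff_mem]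
  exact h.pow_mem

theorem ideal_eq (h : HasUlrichOrder a I l) (h' : HasUlrichOrder a I' l)
    (ha : a ∈ nonZeroDivisors R) : I = I' := by
  rw [h.eq_sup h' ha le_rfl, sup_eq_right, Ideal.span_singleton_le_iff_mem]
  exact h'.pow_mem

end HasUlrichOrder

/-- An Ulrich ideal of order `l ≥ 2` is not contained in `𝔪 ^ l`. -/
theorem IsUlrichFamily.not_le_maximalIdeal_pow {R ι : Type*} [CommRing R] [IsLocalRing R]
    [IsNoetherianRing R] [Fintype ι] {I : Ideal R} {a b : R} {x : ι → R}
    (h : IsUlrichFamily I b x)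
    (hm : maximalIdeal R ^ 2 = Ideal.span {a} * maximalIdeal R) {l : ℕ}
    (hl : HasUlrichOrder a I l) (h2 : 2 ≤ l) : ¬ I ≤ maximalIdeal R ^ l := by
  intro hle
  -- Since `l ≥ 2`, `I ≤ 𝔪 ^ 2 ≤ (a)`. Then `I ≤ (a ^ l)`, and writing `b = s a ^ l` the colon
  -- property yields `s ∈ I`, so `b ∈ 𝔪 I`.
  have h1 : maximalIdeal R ≤ Ideal.span {a} := by
    refine hl.maximalIdeal_le.trans (sup_le le_rfl (hle.trans ((Ideal.pow_le_pow_right h2).trans ?_)))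
    rw [hm]
    exact Ideal.mul_le_left (I := Ideal.span {a}) (J := maximalIdeal R)
  have h3 : I ≤ Ideal.span {a ^ l} := by
    refine hle.trans ((Ideal.pow_right_mono h1 l).trans ?_)
    rw [Ideal.span_singleton_pow]
  obtain ⟨y, hy, hcol⟩ := h.exists_colon_le
  obtain ⟨s, rfl⟩ := Ideal.mem_span_singleton'.1 (h3 h.mem)
  obtain ⟨t, rfl⟩ := Ideal.mem_span_singleton'.1 (h3 hy)
  have hs : s ∈ I := hcol s t (by ring)
  refine h.notMem_mul (Ideal.mul_mem_mul (h.le_maximalIdeal hs) hl.pow_mem)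

/-! ### Hilbert functions and minimal multiplicity. -/

/-- The quotients `m ^ n / m ^ (n + 1)`, as submodules of `R / m ^ (n + 1)`. -/
def gradedPiece {R : Type*} [CommRing R] (m : Ideal R) (n : ℕ) : Submodule R (R ⧸ m ^ (n + 1)) :=
  Submodule.map (m ^ (n + 1)).mkQ (m ^ n)

section GradedPiece

variable {R : Type*} [CommRing R] (m : Ideal R) (n : ℕ)

theorem length_quotient_pow_succ :
    Module.length R (R ⧸ m ^ (n + 1)) =
      Module.length R (gradedPiece m n) + Module.length R (R ⧸ m ^ n) := by
  refine Module.length_eq_add_of_exact (gradedPiece m n).subtype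
    (Submodule.factor (Ideal.pow_le_pow_right n.le_succ)) (Submodule.subtype_injective _)
    (Submodule.factor_surjective _) ?_
  rw [LinearMap.exact_iff, Submodule.range_subtype]
  ext z
  obtain ⟨z, rfl⟩ := Submodule.mkQ_surjective _ z
  change (Submodule.Quotient.mk z : R ⧸ m ^ n) = 0 ↔ _
  rw [Submodule.Quotient.mk_eq_zero, gradedPiece, Submodule.mem_map]
  constructor
  · exact fun h => ⟨z, h, rfl⟩
  · rintro ⟨y, hy, e⟩
    replace e := (Submodule.Quotient.eq _).1 e
    have := sub_mem hy (Ideal.pow_le_pow_right n.le_succ e)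
    rwa [sub_sub_cancel] at this

variable {m n}

/-- Multiplication by `f ∈ m` as a map `m ^ n / m ^ (n + 1) → m ^ (n + 1) / m ^ (n + 2)`. -/
theorem exists_gradedPiece_map {f : R} (hf : f ∈ m)
    (hinj : ∀ s ∈ m ^ n, f * s ∈ m ^ (n + 2) → s ∈ m ^ (n + 1)) :
    ∃ φ : gradedPiece m n →ₗ[R] gradedPiece m (n + 1), Function.Injective φ ∧
      ∀ (s : R) (hs : s ∈ m ^ n), (φ ⟨Submodule.Quotient.mk s, s, hs, rfl⟩ : R ⧸ m ^ (n + 2)) =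
        Submodule.Quotient.mk (f * s) := by
  have h1 : m ^ (n + 1) ≤ Submodule.comap (LinearMap.mulLeft R f) (m ^ (n + 2)) := by
    intro z hz
    rw [Submodule.mem_comap, LinearMap.mulLeft_apply, pow_succ' m (n + 1)]
    exact Ideal.mul_mem_mul hf hz
  refine ⟨((Submodule.mapQ _ _ (LinearMap.mulLeft R f) h1).comp
    (gradedPiece m n).subtype).codRestrict _ ?_, ?_, fun s hs => rfl⟩
  · rintro ⟨_, s, hs, rfl⟩
    refine ⟨f * s, ?_, rfl⟩
    rw [SetLike.mem_coe, pow_succ']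
    exact Ideal.mul_mem_mul hf hs
  · rw [← LinearMap.ker_eq_bot, LinearMap.ker_eq_bot']
    rintro ⟨_, s, hs, rfl⟩ h0
    have h2 : (Submodule.Quotient.mk (f * s) : R ⧸ m ^ (n + 2)) = 0 := congrArg Subtype.val h0
    ext
    exact (Submodule.Quotient.mk_eq_zero _).2
      (hinj s hs ((Submodule.Quotient.mk_eq_zero _).1 h2))

theorem length_gradedPiece_le {f : R} (hf : f ∈ m)
    (hinj : ∀ s ∈ m ^ n, f * s ∈ m ^ (n + 2) → s ∈ m ^ (n + 1)) :
    Module.length R (gradedPiece m n) ≤ Module.length R (gradedPiece m (n + 1)) := by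
  obtain ⟨φ, hφi, -⟩ := exists_gradedPiece_map hf hinj
  exact Module.length_le_of_injective φ hφi

/-- An injection between modules of equal finite length is surjective; surjectivity is the stated
inclusion, ready for Nakayama. -/
theorem pow_succ_le_of_length_eq {f : R} (hf : f ∈ m)
    (hinj : ∀ s ∈ m ^ n, f * s ∈ m ^ (n + 2) → s ∈ m ^ (n + 1))
    (hlen : Module.length R (gradedPiece m n) = Module.length R (gradedPiece m (n + 1)))
    (hfin : Module.length R (gradedPiece m (n + 1)) ≠ ⊤) :
    m ^ (n + 1) ≤ Ideal.span {f} * m ^ n ⊔ m ^ (n + 2) := by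
  obtain ⟨φ, hφi, hφ⟩ := exists_gradedPiece_map hf hinj
  have hφs : LinearMap.range φ = ⊤ := by
    by_contra hne
    obtain ⟨_, _⟩ := isFiniteLength_iff_isNoetherian_isArtinian.1 (Module.length_ne_top_iff.1 hfin)
    have h1 := Submodule.length_lt hne
    rw [← (LinearEquiv.ofInjective φ hφi).length_eq, hlen] at h1
    exact lt_irrefl _ h1
  intro z hz
  obtain ⟨⟨_, s, hs, rfl⟩, e⟩ := LinearMap.range_eq_top.1 hφs ⟨_, z, hz, rfl⟩
  have h1 := congrArg Subtype.val e
  erw [hφ s hs] at h1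
  have h2 := (Submodule.Quotient.eq _).1 h1
  have h3 : z = f * s + -(f * s - z) := by ring
  rw [h3]
  exact Submodule.add_mem_sup (Ideal.mul_mem_mul (Ideal.mem_span_singleton_self f) hs)
    (neg_mem h2)

end GradedPiece

/-- If the partial sums `q` of a sequence of natural numbers which is eventually monotone satisfy
`q n / n → v`, then the sequence takes the value `v` from some point on. -/
theorem exists_eq_of_tendsto_div {h q : ℕ → ℕ} {c v : ℕ} (hq : ∀ n, q (n + 1) = h n + q n)
    (hmono : ∀ n ≥ c, h n ≤ h (n + 1))
    (hlim : Tendsto (fun n : ℕ => (q n : ℝ) / n) atTop (𝓝 v)) :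
    ∃ n ≥ c, h n = v ∧ h (n + 1) = v := by
  have hm {k n : ℕ} (hk : c ≤ k) (hn : k ≤ n) : h k ≤ h n := by
    induction n, hn using Nat.le_induction with
    | base => rfl
    | succ n hn ih => exact ih.trans (hmono n (hk.trans hn))
  have hub (n) (hn : c ≤ n) : h n ≤ v := by
    by_contra! hlt
    -- One value above `v` would, by monotonicity, make the partial sums grow with slope at least `v
    -- + 1`.
    have hge (k : ℕ) (hk : n ≤ k) : (v + 1) * k ≤ q k + (v + 1) * n := by
      induction k, hk using Nat.le_induction with
      | base => omega
      | succ k hk ih =>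
        have := hm hn hk
        rw [hq, mul_add]
        omega
    have hl2 : Tendsto (fun k : ℕ => ((v : ℝ) + 1) - (v + 1) * n / k) atTop
        (𝓝 ((v : ℝ) + 1 - 0)) :=
      tendsto_const_nhds.sub (tendsto_const_div_atTop_nhds_zero_nat _)
    have := le_of_tendsto_of_tendsto hl2 hlim (by
      filter_upwards [eventually_ge_atTop (n + 1)] with k hk
      have hk0 : (0 : ℝ) < k := by exact_mod_cast (by omega : 0 < k)
      have h1 : ((v : ℝ) + 1) * k ≤ q k + (v + 1) * n := by exact_mod_cast hge k (by omega)
      rw [le_div_iff₀ hk0, sub_mul, div_mul_cancel₀ _ hk0.ne']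
      linarith)
    linarith
  have hlb : ∃ n ≥ c, v ≤ h n := by
    by_contra! hlt
    have hle (k : ℕ) (hk : c ≤ k) : q k + k ≤ v * k + (q c + c) := by
      induction k, hk using Nat.le_induction with
      | base => omega
      | succ k hk ih =>
        have := hlt k hk
        rw [hq, mul_add]
        omega
    have hl2 : Tendsto (fun k : ℕ => ((v : ℝ) - 1) + (q c + c : ℕ) / k) atTop
        (𝓝 ((v : ℝ) - 1 + 0)) :=
      tendsto_const_nhds.add (tendsto_const_div_atTop_nhds_zero_nat _)
    have := le_of_tendsto_of_tendsto hlim hl2 (by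
      filter_upwards [eventually_ge_atTop (c + 1)] with k hk
      have hk0 : (0 : ℝ) < k := by exact_mod_cast (by omega : 0 < k)
      have h1 : (q k : ℝ) + k ≤ v * k + (q c + c : ℕ) := by exact_mod_cast hle k (by omega)
      rw [div_le_iff₀ hk0, add_mul, div_mul_cancel₀ _ hk0.ne']
      linarith)
    linarith
  obtain ⟨n, hn, hvn⟩ := hlb
  exact ⟨n, hn, le_antisymm (hub n hn) hvn,
    le_antisymm (hub _ (by omega)) (hvn.trans (hmono n hn))⟩

section LocalRing

variable {R : Type*} [CommRing R] [IsLocalRing R] [IsNoetherianRing R]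

theorem length_quotient_maximalIdeal_pow_ne_top (n : ℕ) :
    Module.length R (R ⧸ maximalIdeal R ^ n) ≠ ⊤ := by
  rcases Nat.eq_zero_or_pos n with rfl | hn
  · rw [pow_zero, Ideal.one_eq_top, Module.length_eq_zero]
    exact ENat.zero_ne_top
  have : IsArtinianRing (R ⧸ maximalIdeal R ^ n) := by
    apply IsLocalRing.quotient_artinian_of_mem_minimalPrimes_of_isLocalRing
    exact ⟨⟨inferInstance, Ideal.pow_le_self hn.ne'⟩, fun J hJ _ => hJ.1.le_of_pow_le hJ.2⟩
  rw [Module.length_ne_top_iff, isFiniteLength_iff_isNoetherian_isArtinian]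
  exact ⟨inferInstance, isArtinian_of_surjective_algebraMap
    (Ideal.Quotient.mk_surjective (I := maximalIdeal R ^ n))⟩

theorem length_quotient_maximalIdeal_sq :
    Module.length R (R ⧸ maximalIdeal R ^ 2) = embDim R + 1 := by
  have hex : Function.Exact (maximalIdeal R).cotangentToQuotientSquare
      (Submodule.factor (Ideal.pow_le_self two_ne_zero) :
        (R ⧸ maximalIdeal R ^ 2) →ₗ[R] R ⧸ maximalIdeal R) := by
    rw [LinearMap.exact_iff]
    ext z
    obtain ⟨z, rfl⟩ := Submodule.mkQ_surjective _ z
    change (Submodule.Quotient.mk z : R ⧸ maximalIdeal R) = 0 ↔ _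
    rw [Submodule.Quotient.mk_eq_zero, LinearMap.mem_range]
    constructor
    · exact fun h => ⟨(maximalIdeal R).toCotangent ⟨z, h⟩, rfl⟩
    · rintro ⟨y, hy⟩
      obtain ⟨⟨y, hym⟩, rfl⟩ := (maximalIdeal R).toCotangent_surjective y
      rw [Ideal.toCotangent_to_quotient_square] at hy
      replace hy := (Submodule.Quotient.eq _).1 hy
      have := sub_mem hym (Ideal.pow_le_self two_ne_zero hy)
      rwa [sub_sub_cancel] at this
  rw [Module.length_eq_add_of_exact _ _ (maximalIdeal R).cotangentToQuotientSquare_injective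
    (Submodule.factor_surjective _) hex]
  congr 1
  · have h1 : Module.length R (CotangentSpace R) =
        Module.length (ResidueField R) (CotangentSpace R) :=
      Module.length_eq_of_surjective residue_surjective
    rw [embDim, spanFinrank_maximalIdeal_eq_finrank_cotangentSpace, ← Module.length_eq_finrank]
    exact h1
  · rw [Module.length_eq_one_iff, isSimpleModule_iff_isCoatom, ← Ideal.isMaximal_def]
    infer_instance

omit [IsLocalRing R] [IsNoetherianRing R] in
theorem length_quotient_span_mul {f : R} (hf : f ∈ nonZeroDivisors R) (J : Ideal R) :
    Module.length R (R ⧸ Ideal.span {f} * J) =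
      Module.length R (R ⧸ J) + Module.length R (R ⧸ Ideal.span {f}) := by
  have h := Module.length_eq_add_of_exact (Ideal.mulQuot f J) (Ideal.quotOfMul f J)
    (Ideal.mulQuot_injective J hf) (Ideal.quotOfMul_surjective J) (Ideal.exact_mulQuot_quotOfMul J)
  rw [← smul_eq_mul, Submodule.ideal_span_singleton_smul]
  exact h

omit [IsLocalRing R] [IsNoetherianRing R] in
theorem eq_of_le_of_length_eq {J K : Ideal R} (hle : J ≤ K)
    (hlen : Module.length R (R ⧸ J) = Module.length R (R ⧸ K))
    (hfin : Module.length R (R ⧸ J) ≠ ⊤) : J = K := by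
  obtain ⟨_, _⟩ := isFiniteLength_iff_isNoetherian_isArtinian.1 (Module.length_ne_top_iff.1 hfin)
  have hb : Submodule.map J.mkQ K = ⊥ := by
    by_contra hne
    have h1 := Submodule.length_quotient_lt _ hne
    rw [(Submodule.quotientQuotientEquivQuotient J K hle).length_eq, hlen] at h1
    exact lt_irrefl _ h1
  refine le_antisymm hle fun z hz => ?_
  have : J.mkQ z ∈ Submodule.map J.mkQ K := ⟨z, hz, rfl⟩
  rw [hb, Submodule.mem_bot] at this
  exact (Submodule.Quotient.mk_eq_zero _).1 this

/-- Minimal multiplicity: a superficial parameter generates a reduction of the maximal ideal with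
reduction number at most one. -/
theorem maximalIdeal_sq_eq_of_superficial {f : R} {c v : ℕ} (hf : f ∈ maximalIdeal R)
    (hf0 : f ∈ nonZeroDivisors R)
    (hinj : ∀ n ≥ c, ∀ s ∈ maximalIdeal R ^ n, f * s ∈ maximalIdeal R ^ (n + 2) →
      s ∈ maximalIdeal R ^ (n + 1))
    (hv : Module.length R (R ⧸ maximalIdeal R ^ 2) = v + 1)
    (hlim : HasMultiplicity (maximalIdeal R) (v : ℝ)) :
    maximalIdeal R ^ 2 = Ideal.span {f} * maximalIdeal R := by
  have hqfin := length_quotient_maximalIdeal_pow_ne_top (R := R)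
  have hsucc := length_quotient_pow_succ (maximalIdeal R)
  have hhfin (n : ℕ) : Module.length R (gradedPiece (maximalIdeal R) n) ≠ ⊤ := by
    intro h
    apply hqfin (n + 1)
    rw [hsucc, h, top_add]
  obtain ⟨n, hn, h1, h2⟩ := exists_eq_of_tendsto_div
    (h := fun n => (Module.length R (gradedPiece (maximalIdeal R) n)).toNat)
    (q := fun n => (Module.length R (R ⧸ maximalIdeal R ^ n)).toNat) (c := c) (v := v)
    (fun n => by rw [hsucc, ENat.toNat_add (hhfin n) (hqfin n)])
    (fun n hn => ENat.toNat_le_toNat (length_gradedPiece_le hf (hinj n hn)) (hhfin _)) hlim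
  replace h1 : Module.length R (gradedPiece (maximalIdeal R) n) = v := by
    rw [← h1, ENat.natCast_toNat (hhfin n)]
  replace h2 : Module.length R (gradedPiece (maximalIdeal R) (n + 1)) = v := by
    rw [← h2, ENat.natCast_toNat (hhfin _)]
  have h3 : maximalIdeal R ^ (n + 1) = Ideal.span {f} * maximalIdeal R ^ n := by
    refine le_antisymm ?_ ?_
    · refine Submodule.le_of_le_smul_of_le_jacobson_bot (IsNoetherian.noetherian _)
        (jacobson_eq_maximalIdeal (⊥ : Ideal R) bot_ne_top).ge ?_
      rw [smul_eq_mul, ← pow_succ']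
      exact pow_succ_le_of_length_eq hf (hinj n hn) (h1.trans h2.symm) (hhfin _)
    · rw [pow_succ']
      exact Ideal.mul_mono_left ((Ideal.span_singleton_le_iff_mem _).2 hf)
  -- The length of `R / 𝔪 ^ (n + 1) = R / f 𝔪 ^ n` is computed in two ways, and the finite length of
  -- `R / 𝔪 ^ n` is cancelled.
  have h4 : Module.length R (R ⧸ Ideal.span {f}) = v := by
    have := hsucc n
    rw [h1, h3, length_quotient_span_mul hf0, add_comm (v : ℕ∞)] at this
    exact ENat.add_right_injective_of_ne_top (hqfin n) this
  have h5 : Module.length R (R ⧸ Ideal.span {f} * maximalIdeal R) =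
      Module.length R (R ⧸ maximalIdeal R ^ 2) := by
    rw [length_quotient_span_mul hf0, h4, hv, add_comm]
    congr 1
    rw [Module.length_eq_one_iff, isSimpleModule_iff_isCoatom, ← Ideal.isMaximal_def]
    infer_instance
  refine (eq_of_le_of_length_eq ?_ h5 (h5 ▸ hqfin 2)).symm
  rw [sq]
  exact Ideal.mul_mono_left ((Ideal.span_singleton_le_iff_mem _).2 hf)

end LocalRing

/-! ### Asymptotic colons and the superficial generic element. -/

section Colon

variable {R : Type*} [CommRing R] {v : ℕ} {x : Fin v → R}

/-- Powers of an ideal containing a nonzerodivisor are asymptotically closed under colons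
(Ratliff): `m ^ (n + 1) : m = m ^ n` for large `n`. -/
theorem exists_forall_mem_pow_of_mul_mem [IsNoetherianRing R]
    {y : R} (hy : y ∈ Ideal.span (Set.range x)) (hy0 : y ∈ nonZeroDivisors R) :
    ∃ c, ∀ n ≥ c, ∀ r, (∀ i, x i * r ∈ Ideal.span (Set.range x) ^ (n + 1)) →
      r ∈ Ideal.span (Set.range x) ^ n := by
  classical
  set m := Ideal.span (Set.range x) with hm
  let φ : R →ₗ[R] (Fin v → R) := LinearMap.pi fun i => LinearMap.mulLeft R (x i)
  have hφ (r : R) (i : Fin v) : φ r i = x i * r := rfl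
  have hφi : Function.Injective φ := by
    rw [← LinearMap.ker_eq_bot, LinearMap.ker_eq_bot']
    intro r hr
    obtain ⟨c, rfl⟩ := Ideal.mem_span_range_iff_exists_fun.1 hy
    refine (mul_left_mem_nonZeroDivisors_eq_zero_iff hy0).1 ?_
    rw [Finset.sum_mul]
    refine Finset.sum_eq_zero fun i _ => ?_
    rw [mul_assoc, ← hφ, hr, Pi.zero_apply, mul_zero]
  -- Artin–Rees for the image of `R` in `R ^ v` under `r ↦ (x_i r)`, which is injective because `m`
  -- contains a nonzerodivisor.
  obtain ⟨k, hk⟩ := Ideal.exists_pow_inf_eq_pow_smul m (LinearMap.range φ)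
  refine ⟨k, fun n hn r hr => ?_⟩
  have h1 : φ r ∈ m ^ (n + 1 - k) • (m ^ k • ⊤ ⊓ LinearMap.range φ) := by
    rw [← hk (n + 1) (by omega)]
    refine ⟨?_, r, rfl⟩
    rw [pi_eq_sum_univ' (φ r)]
    exact Submodule.sum_mem _ fun i _ => Submodule.smul_mem_smul (hr i) trivial
  have h2 : m ^ (n + 1 - k) • (m ^ k • ⊤ ⊓ LinearMap.range φ) ≤ Submodule.map φ (m ^ n) := by
    rw [Submodule.smul_le]
    rintro s hs _ ⟨ht, t, rfl⟩
    rw [← map_smul]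
    refine Submodule.mem_map_of_mem ?_
    have h3 (i : Fin v) : x i * t ∈ m ^ k := by
      have h4 : (m ^ k • ⊤ : Submodule R (Fin v → R)) ≤
          Submodule.comap (LinearMap.proj i) (m ^ k) := by
        rw [Submodule.smul_le]
        exact fun r hr p _ => Ideal.mul_mem_right _ _ hr
      exact h4 ht
    have h5 : m * Ideal.span {t} ≤ m ^ k := by
      rw [hm, Ideal.span_mul_span', Ideal.span_le]
      rintro _ ⟨_, ⟨i, rfl⟩, _, rfl, rfl⟩
      exact h3 i
    have h6 : m ^ (n - k) * (m * Ideal.span {t}) ≤ m ^ n := by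
      refine (Ideal.mul_mono_right h5).trans ?_
      rw [← pow_add, Nat.sub_add_cancel hn]
    rw [← mul_assoc, ← pow_succ, show n - k + 1 = n + 1 - k by omega] at h6
    exact h6 (Ideal.mul_mem_mul hs (Ideal.mem_span_singleton_self t))
  obtain ⟨r', hr', e⟩ := h2 h1
  rwa [← hφi e]

open Polynomial

/-- The generic linear combination of the `x i`. -/
noncomputable def genericElement (x : Fin v → R) : R[X] := ∑ i, C (x i) * X ^ (i : ℕ)

theorem coeff_genericElement_mul (g : R[X]) (k : ℕ) :
    (genericElement x * g).coeff k =
      ∑ i : Fin v, if (i : ℕ) ≤ k then x i * g.coeff (k - i) else 0 := by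
  rw [genericElement, Finset.sum_mul, finsetSum_coeff]
  refine Finset.sum_congr rfl fun i _ => ?_
  rw [mul_assoc, coeff_C_mul, coeff_X_pow_mul']
  split_ifs <;> simp

theorem coeff_genericElement (i : Fin v) : (genericElement x).coeff i = x i := by
  simp [genericElement, coeff_X_pow, Fin.val_inj]

/-- The generic element is superficial: it acts injectively on the graded pieces of large
degree. -/
theorem coeff_mem_of_genericElement_mul {c : ℕ}
    (hc : ∀ n ≥ c, ∀ r, (∀ i, x i * r ∈ Ideal.span (Set.range x) ^ (n + 1)) →
      r ∈ Ideal.span (Set.range x) ^ n)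
    (d : ℕ) : ∀ n ≥ c, ∀ g : R[X], (∀ k, g.coeff k ∈ Ideal.span (Set.range x) ^ n) →
      (∀ k ≥ d, g.coeff k ∈ Ideal.span (Set.range x) ^ (n + 1)) →
      (∀ k, (genericElement x * g).coeff k ∈ Ideal.span (Set.range x) ^ (n + 2)) →
      ∀ k, g.coeff k ∈ Ideal.span (Set.range x) ^ (n + 1) := by
  set m := Ideal.span (Set.range x)
  have hx (i : Fin v) : x i ∈ m := Ideal.subset_span ⟨i, rfl⟩
  have hxm {i : Fin v} {n : ℕ} {r : R} (hr : r ∈ m ^ n) : x i * r ∈ m ^ (n + 1) := by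
    rw [pow_succ']
    exact Ideal.mul_mem_mul (hx i) hr
  induction d with
  | zero => exact fun n _ g _ hd _ k => hd k k.zero_le
  | succ d ih =>
    intro n hn g hg hd hfg
    refine ih n hn g hg (fun k hk => ?_) hfg
    rcases hk.eq_or_lt with rfl | hk
    swap
    · exact hd k hk
    refine hc (n + 1) (by omega) _ fun i => ?_
    -- Descending induction on `i`: in the coefficient of degree `i + d` of the product, terms with
    -- index below `i` involve coefficients of `g` beyond `d`, and those above `i` are covered by
    -- the inner induction.
    suffices ∀ j : ℕ, ∀ i : Fin v, v ≤ i + j → ∀ k, x i * g.coeff k ∈ m ^ (n + 2) from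
      this v i (by omega) d
    intro j
    induction j with
    | zero => intro i hi; omega
    | succ j ihj =>
      intro i hi
      have htop : x i * g.coeff d ∈ m ^ (n + 2) := by
        have h1 := hfg (i + d)
        rw [coeff_genericElement_mul, ← Finset.add_sum_erase _ _ (Finset.mem_univ i),
          if_pos (by omega), Nat.add_sub_cancel_left] at h1
        refine (Ideal.add_mem_iff_left _ (Ideal.sum_mem _ fun l hl => ?_)).1 h1
        have hli : (l : ℕ) ≠ i := fun h => Finset.ne_of_mem_erase hl (Fin.ext h)
        split_ifs with hle
        · rcases lt_or_gt_of_ne hli with h | h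
          · exact hxm (hd _ (by omega))
          · exact ihj l (by omega) _
        · exact zero_mem _
      -- The inner induction needs all coefficients of `x_i g`, not only the one of degree `d`; the
      -- outer hypothesis, one power higher, provides them.
      have h2 := ih (n + 1) (by omega) (C (x i) * g) (fun k => by
          rw [coeff_C_mul]; exact hxm (hg k)) (fun k hk => by
          rw [coeff_C_mul]
          rcases hk.eq_or_lt with rfl | hk
          · exact htop
          · exact hxm (hd k hk)) (fun k => by
          rw [mul_left_comm, coeff_C_mul]
          exact hxm (hfg k))
      intro k
      simpa only [coeff_C_mul] using h2 k

theorem genericElement_mem_nonZeroDivisors {y : R} (hy : y ∈ Ideal.span (Set.range x))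
    (hy0 : y ∈ nonZeroDivisors R) : genericElement x ∈ nonZeroDivisors R[X] := by
  rw [Polynomial.mem_nonZeroDivisors_iff]
  intro a ha
  obtain ⟨c, rfl⟩ := Ideal.mem_span_range_iff_exists_fun.1 hy
  refine (mul_right_mem_nonZeroDivisors_eq_zero_iff hy0).1 ?_
  rw [Finset.mul_sum]
  refine Finset.sum_eq_zero fun i _ => ?_
  have := congrArg (fun p : R[X] => p.coeff i) ha
  simp only [coeff_smul, coeff_genericElement, coeff_zero, smul_eq_mul] at this
  rw [mul_left_comm, this, mul_zero]

end Colon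

/-! ### The extension of `R` to the localization of `R[X]` at `𝔪 R[X]`. -/

section Extension

open Polynomial

variable {R : Type*} [CommRing R] [IsLocalRing R] {S : Type*} [CommRing S] [Algebra R[X] S]
  [Algebra R S] [IsScalarTower R R[X] S]

instance isPrime_map_C_maximalIdeal : ((maximalIdeal R).map (C : R →+* R[X])).IsPrime :=
  Ideal.isPrime_map_C_of_isPrime

variable [IsLocalization.AtPrime S ((maximalIdeal R).map (C : R →+* R[X]))]

/-- Membership in an extended ideal becomes a coefficientwise condition over `R`, up to a multiplier
`u` having a unit coefficient. -/
theorem algebraMap_mem_map_iff {K : Ideal R} {p : R[X]} :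
    algebraMap R[X] S p ∈ K.map (algebraMap R S) ↔
      ∃ u ∉ (maximalIdeal R).map (C : R →+* R[X]), ∀ k, (u * p).coeff k ∈ K := by
  have h1 : K.map (algebraMap R S) = (K.map (C : R →+* R[X])).map (algebraMap R[X] S) := by
    rw [Ideal.map_map, IsScalarTower.algebraMap_eq R R[X] S]
    rfl
  rw [h1, IsLocalization.algebraMap_mem_map_algebraMap_iff
    ((maximalIdeal R).map (C : R →+* R[X])).primeCompl]
  simp only [Ideal.mem_map_C_iff (I := K)]
  rfl

theorem exists_isUnit_coeff {u : R[X]} (hu : u ∉ (maximalIdeal R).map (C : R →+* R[X])) :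
    ∃ k, IsUnit (u.coeff k) := by
  rw [Ideal.mem_map_C_iff] at hu
  push Not at hu
  obtain ⟨k, hk⟩ := hu
  exact ⟨k, not_not.1 fun h => hk ((mem_maximalIdeal _).2 h)⟩

theorem mem_of_algebraMap_mem_map {K : Ideal R} {r : R}
    (hr : algebraMap R S r ∈ K.map (algebraMap R S)) : r ∈ K := by
  rw [IsScalarTower.algebraMap_apply R R[X] S] at hr
  obtain ⟨u, hu, h⟩ := algebraMap_mem_map_iff.1 hr
  obtain ⟨k, hk⟩ := exists_isUnit_coeff hu
  have := h k
  rw [Polynomial.algebraMap_apply, Algebra.algebraMap_self_apply, coeff_mul_C] at this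
  exact (Ideal.unit_mul_mem_iff_mem K hk).1 this

theorem map_le_map_iff_of_extension {K L : Ideal R} :
    K.map (algebraMap R S) ≤ L.map (algebraMap R S) ↔ K ≤ L :=
  ⟨fun h _ hr => mem_of_algebraMap_mem_map (h (Ideal.mem_map_of_mem _ hr)), Ideal.map_mono⟩

/-- Independence relations over `R` persist in the extension. -/
theorem mem_map_of_sum_mem_map {ι : Type*} [Fintype ι] {z : ι → R} {K L : Ideal R}
    (h : ∀ r : ι → R, ∑ i, r i * z i ∈ K → ∀ i, r i ∈ L) (s : ι → S)
    (hs : ∑ i, s i * algebraMap R S (z i) ∈ K.map (algebraMap R S)) (i : ι) :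
    s i ∈ L.map (algebraMap R S) := by
  obtain ⟨d, hd⟩ := IsLocalization.exist_integer_multiples_of_finite
    ((maximalIdeal R).map (C : R →+* R[X])).primeCompl s
  choose p hp using hd
  have hsum : algebraMap R[X] S (∑ i, p i * C (z i)) ∈ K.map (algebraMap R S) := by
    have : algebraMap R[X] S (∑ i, p i * C (z i)) =
        algebraMap R[X] S d * ∑ i, s i * algebraMap R S (z i) := by
      rw [map_sum, Finset.mul_sum]
      refine Finset.sum_congr rfl fun i _ => ?_
      rw [map_mul, hp, Algebra.smul_def, mul_assoc, IsScalarTower.algebraMap_apply R R[X] S]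
      rfl
    rw [this]
    exact Ideal.mul_mem_left _ _ hs
  obtain ⟨u, hu, hk⟩ := algebraMap_mem_map_iff.1 hsum
  have h1 : algebraMap R[X] S (p i) ∈ L.map (algebraMap R S) := by
    refine algebraMap_mem_map_iff.2 ⟨u, hu, fun k => h (fun i => (u * p i).coeff k) ?_ i⟩
    have := hk k
    rw [Finset.mul_sum, finsetSum_coeff] at this
    simpa only [← mul_assoc, coeff_mul_C] using this
  rw [hp, Algebra.smul_def] at h1
  exact (Ideal.unit_mul_mem_iff_mem _ (IsLocalization.map_units S d)).1 h1

variable (S) in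
theorem map_maximalIdeal_eq [IsLocalRing S] :
    (maximalIdeal R).map (algebraMap R S) = maximalIdeal S := by
  rw [← IsLocalization.AtPrime.map_eq_maximalIdeal ((maximalIdeal R).map (C : R →+* R[X])) S,
    Ideal.map_map, IsScalarTower.algebraMap_eq R R[X] S]
  rfl

variable (S) in
theorem map_maximalIdeal_pow_eq [IsLocalRing S] (n : ℕ) :
    (maximalIdeal R ^ n).map (algebraMap R S) = maximalIdeal S ^ n := by
  rw [Ideal.map_pow, map_maximalIdeal_eq]

variable (S) in
theorem algebraMap_mem_nonZeroDivisors_of_extension {b : R} (hb : b ∈ nonZeroDivisors R) :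
    algebraMap R S b ∈ nonZeroDivisors S := by
  rw [mem_nonZeroDivisors_iff_right]
  intro s hs
  have := mem_map_of_sum_mem_map (z := fun _ : Unit => b) (K := ⊥) (L := ⊥)
    (fun r hr i => by simpa [mul_right_mem_nonZeroDivisors_eq_zero_iff hb] using hr)
    (fun _ => s) (by simp [hs]) ()
  simpa using this

variable (S) in
-- The basis of `I / I ^ 2` is encoded by elements of `R`, so its independence passes to `S` by
-- clearing denominators.
theorem IsUlrichFamily.map_extension [IsLocalRing S] {ι : Type*} [Fintype ι] {I : Ideal R} {b : R}
    {x : ι → R} (h : IsUlrichFamily I b x) :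
    IsUlrichFamily (I.map (algebraMap R S)) (algebraMap R S b) (fun i => algebraMap R S (x i)) where
  le_maximalIdeal := map_maximalIdeal_eq (R := R) S ▸ Ideal.map_mono h.le_maximalIdeal
  exists_pow_le := by
    obtain ⟨N, hN⟩ := h.exists_pow_le
    exact ⟨N, map_maximalIdeal_pow_eq (R := R) S N ▸ Ideal.map_mono hN⟩
  mem := Ideal.mem_map_of_mem _ h.mem
  mem_nonZeroDivisors := algebraMap_mem_nonZeroDivisors_of_extension S h.mem_nonZeroDivisors
  sq_eq := by
    rw [← Ideal.map_pow, h.sq_eq, Ideal.map_mul, Ideal.map_span, Set.image_singleton]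
  ne_span := by
    rw [← Set.image_singleton, ← Ideal.map_span]
    exact fun e => h.ne_span (le_antisymm ((map_le_map_iff_of_extension (S := S)).1 e.le)
      ((map_le_map_iff_of_extension (S := S)).1 e.ge))
  span_eq := by
    conv_rhs => rw [← h.span_eq, Ideal.map_span, ← Set.range_comp]
    rfl
  mem_of_sum_mem := by
    rw [← Ideal.map_pow]
    exact mem_map_of_sum_mem_map h.mem_of_sum_mem

theorem mem_pow_of_genericElement_mul_mem [IsLocalRing S] {v : ℕ} {x : Fin v → R}
    (hx : Ideal.span (Set.range x) = maximalIdeal R) {c : ℕ}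
    (hc : ∀ n ≥ c, ∀ r, (∀ i, x i * r ∈ Ideal.span (Set.range x) ^ (n + 1)) →
      r ∈ Ideal.span (Set.range x) ^ n) {n : ℕ} (hn : c ≤ n) {s : S}
    (hs : s ∈ maximalIdeal S ^ n)
    (hfs : algebraMap R[X] S (genericElement x) * s ∈ maximalIdeal S ^ (n + 2)) :
    s ∈ maximalIdeal S ^ (n + 1) := by
  rw [← map_maximalIdeal_pow_eq (R := R)] at hs hfs ⊢
  obtain ⟨⟨p, d⟩, hp⟩ := IsLocalization.surj
    ((maximalIdeal R).map (C : R →+* R[X])).primeCompl s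
  have hd := IsLocalization.map_units S d
  rw [← Ideal.mul_unit_mem_iff_mem _ hd] at hs hfs ⊢
  rw [mul_assoc] at hfs
  rw [hp] at hs hfs ⊢
  rw [← map_mul] at hfs
  obtain ⟨u, hu, h1⟩ := algebraMap_mem_map_iff.1 hs
  obtain ⟨u', hu', h2⟩ := algebraMap_mem_map_iff.1 hfs
  refine algebraMap_mem_map_iff.2 ⟨u * u', fun h => ?_, ?_⟩
  · exact (isPrime_map_C_maximalIdeal.mem_or_mem h).elim hu hu'
  · have hmul {K : Ideal R} {q w : R[X]} (h : ∀ k, q.coeff k ∈ K) (k : ℕ) :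
        (w * q).coeff k ∈ K :=
      Ideal.mem_map_C_iff.1 (Ideal.mul_mem_left _ w (Ideal.mem_map_C_iff.2 h)) k
    have key := coeff_mem_of_genericElement_mul (x := x) (c := c) (by simpa only [hx] using hc)
    simp only [hx] at key
    refine key ((u * u' * p).natDegree + 1) n hn _ ?_ ?_ ?_
    · rw [mul_comm u, mul_assoc]
      exact hmul h1
    · intro k hk
      rw [coeff_eq_zero_of_natDegree_lt (Nat.lt_of_succ_le hk)]
      exact zero_mem _
    · rw [show genericElement x * (u * u' * p) = u * (u' * (genericElement x * p)) by ring]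
      exact hmul h2

/-- `S` is flat over `R` with a local structure map, so lengths are multiplied by that of `S / 𝔪 S`,
the residue field of `S`. -/
theorem length_quotient_map_eq [IsLocalRing S] (J : Ideal R) :
    Module.length S (S ⧸ J.map (algebraMap R S)) = Module.length R (R ⧸ J) := by
  have : Module.Flat R[X] S :=
    IsLocalization.flat S ((maximalIdeal R).map (C : R →+* R[X])).primeCompl
  have : Module.Flat R S := Module.Flat.trans R R[X] S
  have : IsLocalHom (algebraMap R S) := by
    refine ((local_hom_TFAE (algebraMap R S)).out 0 2).2 ?_
    exact (map_maximalIdeal_eq (R := R) S).le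
  have h := IsLocalRing.length_baseChange R S (R ⧸ J)
  rw [(Algebra.TensorProduct.quotIdealMapEquivTensorQuot S J).toLinearEquiv.length_eq, h,
    map_maximalIdeal_eq, Module.length_eq_one_iff (M := S ⧸ maximalIdeal S) |>.2, mul_one]
  rw [isSimpleModule_iff_isCoatom, ← Ideal.isMaximal_def]
  infer_instance

/-- Over the extension `S` of `R`, with infinite residue field, the maximal ideal of a ring of
minimal multiplicity has a principal reduction with reduction number at most one. -/
theorem exists_maximalIdeal_sq_eq [IsNoetherianRing R] [IsLocalRing S] [IsNoetherianRing S]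
    {y : R} (hy : y ∈ maximalIdeal R) (hy0 : y ∈ nonZeroDivisors R)
    (hmin : HasMinimalMultiplicity R) :
    ∃ f ∈ maximalIdeal S, f ∈ nonZeroDivisors S ∧
      maximalIdeal S ^ 2 = Ideal.span {f} * maximalIdeal S := by
  obtain ⟨v, x, hx⟩ := Submodule.fg_iff_exists_fin_generating_family.1
    (maximalIdeal R).fg_of_isNoetherianRing
  replace hx : Ideal.span (Set.range x) = maximalIdeal R := hx
  have hyx : y ∈ Ideal.span (Set.range x) := hx ▸ hy
  obtain ⟨c, hc⟩ := exists_forall_mem_pow_of_mul_mem hyx hy0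
  have hf0 : algebraMap R[X] S (genericElement x) ∈ nonZeroDivisors S :=
    IsLocalization.map_nonZeroDivisors_le
      ((maximalIdeal R).map (C : R →+* R[X])).primeCompl S
      ⟨_, genericElement_mem_nonZeroDivisors hyx hy0, rfl⟩
  have hfm : algebraMap R[X] S (genericElement x) ∈ maximalIdeal S := by
    rw [← map_maximalIdeal_eq (R := R) S, genericElement, map_sum]
    refine Ideal.sum_mem _ fun i _ => ?_
    rw [map_mul]
    refine Ideal.mul_mem_right _ _ ?_
    have : algebraMap R[X] S (C (x i)) = algebraMap R S (x i) :=
      (IsScalarTower.algebraMap_apply R R[X] S (x i)).symm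
    rw [this]
    exact Ideal.mem_map_of_mem _ (hx ▸ Ideal.subset_span ⟨i, rfl⟩)
  refine ⟨_, hfm, hf0, maximalIdeal_sq_eq_of_superficial hfm hf0 (c := c) (v := embDim R)
    (fun n hn s hs hfs => mem_pow_of_genericElement_mul_mem hx hc hn hs hfs) ?_ ?_⟩
  · rw [← map_maximalIdeal_pow_eq (R := R), length_quotient_map_eq,
      length_quotient_maximalIdeal_sq]
  · have : HasMultiplicity (maximalIdeal R) (embDim R : ℝ) := hmin
    have hlen (n : ℕ) : Module.length S (S ⧸ maximalIdeal S ^ n) =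
        Module.length R (R ⧸ maximalIdeal R ^ n) := by
      rw [← map_maximalIdeal_pow_eq (R := R), length_quotient_map_eq]
    unfold HasMultiplicity at this ⊢
    simpa only [hlen] using this

end Extension

/-! ### From the definition of an Ulrich ideal to an explicit basis. -/

section Ulrich

variable {R : Type*} [CommRing R] [IsLocalRing R] [IsNoetherianRing R]

theorem exists_mem_maximalIdeal_nonZeroDivisors (hCM : IsCohenMacaulayLocal R)
    (hdim : ringKrullDim R = 1) : ∃ y ∈ maximalIdeal R, y ∈ nonZeroDivisors R := by
  obtain ⟨rs, hrs, hlen⟩ := hCM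
  rw [hdim] at hlen
  have h1 : rs.length = 1 := by exact_mod_cast hlen
  obtain ⟨y, rfl⟩ := List.length_eq_one_iff.1 h1
  refine ⟨y, ?_, ?_⟩
  · rw [mem_maximalIdeal]
    intro hu
    apply hrs.top_ne_smul
    rw [Ideal.ofList_singleton, Ideal.span_singleton_eq_top.2 hu, Submodule.top_smul]
  · have h2 := hrs.toIsWeaklyRegular
    rw [RingTheory.Sequence.isWeaklyRegular_singleton_iff] at h2
    rw [mem_nonZeroDivisors_iff_right]
    intro r hr
    refine h2 (?_ : y • r = y • 0)
    rw [smul_zero, smul_eq_mul, mul_comm, hr]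

theorem IsUlrichIdeal.exists_isUlrichFamily (hCM : IsCohenMacaulayLocal R)
    (hdim : ringKrullDim R = 1) {I : Ideal R} (hI : IsUlrichIdeal I) :
    ∃ (n : ℕ) (b : R) (x : Fin n → R), IsUlrichFamily I b x := by
  classical
  obtain ⟨⟨hprim, hrad⟩, Q, ⟨hQrad, d, hd, a, hQ⟩, ⟨hQI, _⟩, hne, hsq, hfree⟩ := hI
  obtain ⟨y, hym, hy0⟩ := exists_mem_maximalIdeal_nonZeroDivisors hCM hdim
  rw [hdim] at hd
  obtain rfl : d = 1 := by
    have : ((1 : ℕ) : WithBot ℕ∞) = (d : ℕ) := by exact_mod_cast hd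
    exact_mod_cast this.symm
  obtain ⟨b, rfl⟩ : ∃ b, Q = Ideal.span {b} := ⟨a 0, by rw [hQ, Set.range_unique]; rfl⟩
  have hbI : b ∈ I := hQI (Ideal.mem_span_singleton_self b)
  have hb0 : b ∈ nonZeroDivisors R := by
    rw [← hQrad] at hym
    obtain ⟨N, hN⟩ := hym
    obtain ⟨c, hc⟩ := Ideal.mem_span_singleton'.1 hN
    have := pow_mem hy0 N
    rw [← hc] at this
    exact (mul_mem_nonZeroDivisors.1 this).2
  have hIm : I ≤ maximalIdeal R := hrad ▸ Ideal.le_radical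
  have hnt : Nontrivial (R ⧸ I) := Ideal.Quotient.nontrivial_iff.2 hprim.1
  have : Module.Finite R I.Cotangent :=
    Module.Finite.of_surjective I.toCotangent I.toCotangent_surjective
  have hfin : Module.Finite (R ⧸ I) I.Cotangent :=
    Module.Finite.of_restrictScalars_finite R (R ⧸ I) I.Cotangent
  let B := Module.finBasis (R ⧸ I) I.Cotangent
  choose x hx using fun i => I.toCotangent_surjective (B i)
  have hsum (r : Fin (Module.finrank (R ⧸ I) I.Cotangent) → R) :
      I.toCotangent (∑ i, r i • x i) = ∑ i, (Ideal.Quotient.mk I (r i)) • B i := by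
    rw [map_sum]
    refine Finset.sum_congr rfl fun i _ => ?_
    rw [map_smul, hx, ← algebraMap_smul (R ⧸ I) (r i) (B i)]
    rfl
  have hcoe (r : Fin (Module.finrank (R ⧸ I) I.Cotangent) → R) :
      ((∑ i, r i • x i : I) : R) = ∑ i, r i * (x i : R) := by
    simp
  refine ⟨_, b, fun i => x i, hIm, ?_, hbI, hb0, hsq, hne, ?_, ?_⟩
  · have := I.exists_radical_pow_le_of_fg (IsNoetherian.noetherian _)
    rwa [hrad] at this
  · refine le_antisymm (Ideal.span_le.2 ?_) ?_
    · rintro _ ⟨i, rfl⟩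
      exact (x i).2
    -- Nakayama: lifts of a basis of `I / I ^ 2` generate `I`.
    · refine Submodule.le_of_le_smul_of_le_jacobson_bot (I := I) (IsNoetherian.noetherian _)
        (hIm.trans (jacobson_eq_maximalIdeal (⊥ : Ideal R) bot_ne_top).ge) ?_
      intro z hz
      have h1 := B.sum_repr (I.toCotangent ⟨z, hz⟩)
      choose r hr using fun i => Ideal.Quotient.mk_surjective (B.repr (I.toCotangent ⟨z, hz⟩) i)
      simp only [← hr] at h1
      rw [← hsum, eq_comm, Ideal.toCotangent_eq, hcoe] at h1
      rw [← add_sub_cancel (∑ i, r i * (x i : R)) z]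
      refine Submodule.add_mem_sup (Ideal.sum_mem _ fun i _ =>
        Ideal.mul_mem_left _ _ (Ideal.subset_span ⟨i, rfl⟩)) ?_
      rw [smul_eq_mul, ← sq]
      exact h1
  · intro r hr i
    rw [← hcoe, ← Ideal.toCotangent_eq_zero, hsum] at hr
    exact Ideal.Quotient.eq_zero_iff_mem.1
      (Fintype.linearIndependent_iff.1 B.linearIndependent _ hr i)

end Ulrich

/-! ### Limits in the completion and the conclusion. -/

/-- If the `m`-adic completion is reduced, then a Cauchy sequence whose squares tend to zero tends
to zero. -/
theorem mem_pow_of_isReduced_adicCompletion {R : Type*} [CommRing R] {m : Ideal R}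
    (hred : IsReduced (AdicCompletion m R)) {z : ℕ → R}
    (hcauchy : ∀ n, z (n + 1) - z n ∈ m ^ n) (hsq : ∀ n, z n ^ 2 ∈ m ^ n) (n : ℕ) :
    z n ∈ m ^ n := by
  let ζ : AdicCompletion.AdicCauchySequence m R := AdicCompletion.AdicCauchySequence.mk m R z
    fun n => by
      rw [SModEq.sub_mem, ← neg_mem_iff, neg_sub, smul_eq_mul, Ideal.mul_top]
      exact hcauchy n
  have heval (n : ℕ) : AdicCompletion.evalₐ m n (AdicCompletion.mk m R ζ) =
      Ideal.Quotient.mk (m ^ n) (z n) := AdicCompletion.evalₐ_mk m n ζ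
  have h0 : AdicCompletion.mk m R ζ ^ 2 = 0 := by
    refine AdicCompletion.ext_evalₐ fun n => ?_
    rw [map_pow, heval, map_zero, ← map_pow, Ideal.Quotient.eq_zero_iff_mem]
    exact hsq n
  have h1 := heval n
  rw [eq_zero_of_pow_eq_zero h0, map_zero, eq_comm, Ideal.Quotient.eq_zero_iff_mem] at h1
  exact h1

/-- A family of ideals indexed by orders `l` such that `I' ≤ I ≤ I' + m ^ l` whenever the order
`l` of `I` is at most that of `I'`, with `I ^ 2 ≤ m ^ l`. If the orders are unbounded and the
completion is reduced, then `I ≤ m ^ l`. -/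
theorem le_pow_of_isReduced_adicCompletion {R : Type*} [CommRing R] {m : Ideal R}
    (hred : IsReduced (AdicCompletion m R)) {P : Ideal R → ℕ → Prop}
    (hunb : ∀ N, ∃ I l, N ≤ l ∧ P I l)
    (hle : ∀ I l I' l', P I l → P I' l' → l ≤ l' → I ≤ I' ⊔ m ^ l)
    (hsq : ∀ I l, P I l → I ^ 2 ≤ m ^ l) {I : Ideal R} {l : ℕ} (hI : P I l) : I ≤ m ^ l := by
  intro y hy
  let T := {p : Ideal R × ℕ × R // P p.1 p.2.1 ∧ p.2.2 ∈ p.1}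
  have hstep (n : ℕ) (p : T) : ∃ q : T, n + 1 ≤ q.1.2.1 ∧ p.1.2.1 ≤ q.1.2.1 ∧
      q.1.2.2 - p.1.2.2 ∈ m ^ p.1.2.1 := by
    obtain ⟨⟨J, k, t⟩, hJ, ht⟩ := p
    -- The maximum makes the orders nondecreasing and the order at stage `n` at least `n`, which
    -- gives the Cauchy condition and squares tending to zero.
    obtain ⟨J', k', hk', hJ'⟩ := hunb (max (n + 1) k)
    obtain ⟨t', ht', s, hs, e⟩ := Submodule.mem_sup.1
      (hle J k J' k' hJ hJ' ((le_max_right _ _).trans hk') ht)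
    refine ⟨⟨(J', k', t'), hJ', ht'⟩, (le_max_left _ _).trans hk', (le_max_right _ _).trans hk', ?_⟩
    have : t' - t = -s := by
      change t' + s = t at e
      rw [← e]
      ring
    simp only [this, neg_mem_iff]
    exact hs
  choose step h1 h2 h3 using hstep
  let seq : ℕ → T := fun n => Nat.rec ⟨(I, l, y), hI, hy⟩ step n
  have hsucc (n : ℕ) : seq (n + 1) = step n (seq n) := rfl
  have hord (n : ℕ) : n ≤ (seq n).1.2.1 := by
    cases n with
    | zero => exact Nat.zero_le _
    | succ n => rw [hsucc]; exact h1 _ _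
  have hordl (n : ℕ) : l ≤ (seq n).1.2.1 := by
    induction n with
    | zero => exact le_rfl
    | succ n ih => rw [hsucc]; exact ih.trans (h2 _ _)
  have hcl (n : ℕ) : (seq n).1.2.2 - y ∈ m ^ l := by
    induction n with
    | zero => simp [seq]
    | succ n ih =>
      rw [hsucc, ← sub_add_sub_cancel _ (seq n).1.2.2]
      exact add_mem (Ideal.pow_le_pow_right (hordl n) (h3 _ _)) ih
  have key := mem_pow_of_isReduced_adicCompletion hred (z := fun n => (seq n).1.2.2)
    (fun n => by rw [hsucc]; exact Ideal.pow_le_pow_right (hord n) (h3 _ _))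
    (fun n => Ideal.pow_le_pow_right (hord n)
      (hsq _ _ (seq n).2.1 (Ideal.pow_mem_pow (seq n).2.2 2))) l
  have := sub_mem key (hcl l)
  rwa [sub_sub_cancel] at this

theorem corollary5 (R : Type*) [CommRing R] [IsLocalRing R] [IsNoetherianRing R]
    (hCM : IsCohenMacaulayLocal R) (hdim : ringKrullDim R = 1)
    (hmin : HasMinimalMultiplicity R)
    (hred : IsReduced (AdicCompletion (maximalIdeal R) R)) :
    {I : Ideal R | IsUlrichIdeal I}.Finite := by
  obtain ⟨y, hym, hy0⟩ := exists_mem_maximalIdeal_nonZeroDivisors hCM hdim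
  let S := Localization.AtPrime ((maximalIdeal R).map (Polynomial.C : R →+* Polynomial R))
  have : IsNoetherianRing S := IsLocalization.isNoetherianRing
    ((maximalIdeal R).map (Polynomial.C : R →+* Polynomial R)).primeCompl S inferInstance
  obtain ⟨f, hfm, hf0, hsq⟩ := exists_maximalIdeal_sq_eq (S := S) hym hy0 hmin
  let P : Ideal R → ℕ → Prop := fun I l => HasUlrichOrder f (I.map (algebraMap R S)) l
  have hex (I : Ideal R) (hI : IsUlrichIdeal I) : ∃ l, P I l := by
    obtain ⟨n, b, x, hx⟩ := hI.exists_isUlrichFamily hCM hdim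
    exact (hx.map_extension S).exists_hasUlrichOrder hfm hf0 hsq
  choose! ord hord using hex
  by_contra hinf
  have hinj : Set.InjOn ord {I : Ideal R | IsUlrichIdeal I} := by
    intro I hI J hJ e
    have := (hord I hI).ideal_eq (e ▸ hord J hJ) hf0
    exact le_antisymm ((map_le_map_iff_of_extension (S := S)).1 this.le)
      ((map_le_map_iff_of_extension (S := S)).1 this.ge)
  have hunb (N : ℕ) : ∃ I, IsUlrichIdeal I ∧ N ≤ ord I := by
    obtain ⟨_, ⟨I, hI, rfl⟩, hN⟩ := (Set.Infinite.image hinj hinf).exists_gt N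
    exact ⟨I, hI, hN.le⟩
  -- Order at least `2` is what `not_le_maximalIdeal_pow` requires.
  obtain ⟨I, hI, hl⟩ := hunb 2
  have hle := le_pow_of_isReduced_adicCompletion hred (P := P)
    (fun N => by
      obtain ⟨I, hI, hN⟩ := hunb N
      exact ⟨I, _, hN, hord I hI⟩)
    (fun I l I' l' h h' hl => by
      rw [← map_le_map_iff_of_extension (S := S), Ideal.map_sup, map_maximalIdeal_pow_eq,
        h.eq_sup h' hf0 hl, sup_comm]
      refine sup_le_sup le_rfl ((Ideal.span_singleton_le_iff_mem _).2 (Ideal.pow_mem_pow hfm _)))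
    (fun I l h => by
      rw [← map_le_map_iff_of_extension (S := S), map_maximalIdeal_pow_eq, Ideal.map_pow, sq,
        Ideal.mul_le]
      intro r hr s hs
      obtain ⟨w, _, e⟩ := h.sq_le r hr s hs
      rw [e]
      exact Ideal.mul_mem_right _ _ (Ideal.pow_mem_pow hfm _))
    (hord I hI)
  obtain ⟨n, b, x, hx⟩ := hI.exists_isUlrichFamily hCM hdim
  refine (hx.map_extension S).not_le_maximalIdeal_pow hsq (hord I hI) hl ?_
  rw [← map_maximalIdeal_pow_eq (R := R) S]
  exact Ideal.map_mono hle
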